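/- Let $d\ge 1$ and let $\Omega\subset\mathbb R^d$ be a bounded open set (for instance a bounded Lipschitz domain). Write $\|\cdot\|$ for the norm of $L^2(\Omega)$ and of $[L^2(\Omega)]^d$, let $V=H^1_0(\Omega)$ be the closure of $C_c^\infty(\Omega)$ in the $H^1(\Omega)$-norm, and let $H(\mathrm{div},\Omega)$ be the space of all $\tau\in[L^2(\Omega)]^d$ with weak divergence $\mathrm{div}\,\tau\in L^2(\Omega)$. Let $y_d,u_d,f,u_a,u_b\in L^2(\Omega)$ with $u_a\le u_b$ a.e. in $\Omega$, let $\lambda>0$, and let $\nu\in L^\infty(\Omega)$ satisfy $\nu\ge\underline\nu$ a.e. in $\Omega$ for a constant $\underline\nu>0$. Put $U_{\rm ad}=\{v\in L^2(\Omega): u_a\le v\le u_b \text{ a.e. in } \Omega\}$. For $v\in L^2(\Omega)$ the state $y(v)\in V$ is the weak solution of $-\mathrm{div}(\nu\nabla y)=f+v$, that is $$\int_\Omega \nu\nabla y(v)\cdot\nabla w\,dx=\int_\Omega (f+v)\,w\,dx\qquad\forall\, w\in V,$$ and the cost is $\mathcal J(y(v),v)=\tfrac12\|y(v)-y_d\|^2+\tfrac\lambda2\|v-u_d\|^2$,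 to be minimized over $v\in U_{\rm ad}$. The associated optimality system for $(y,u,p)\in V\times U_{\rm ad}\times V$ is: $y=y(u)$, $\int_\Omega\nu\nabla p\cdot\nabla w\,dx=\int_\Omega(y-y_d)\,w\,dx$ for all $w\in V$, and $\int_\Omega(p+\lambda(u-u_d))(w-u)\,dx\ge0$ for all $w\in U_{\rm ad}$. For $\zeta\in V$ let $v_\zeta=\min\{u_b,\max\{u_a,u_d-\zeta/\lambda\}\}$ (pointwise a.e.). For $C_F>0$, $\eta,\zeta\in V$, $\tau,\rho\in H(\mathrm{div},\Omega)$ and $v\in L^2(\Omega)$ set $$\begin{aligned}\mathcal J^\ominus(\eta,\zeta,\tau,\rho,v)={}&\tfrac12\|\eta-y_d\|^2+\tfrac\lambda2\|v-u_d\|^2+\int_\Omega(f+v+\mathrm{div}\,\tau)\,\zeta\,dx+\int_\Omega(\tau-\nu\nabla\eta)\cdot\nabla\zeta\,dx\\&-\frac1{\underline\nu}\Big(C_F\|\eta-y_d+\mathrm{div}\,\rho\|+\|\rho-\nu\nabla\zeta\|\Big)\\&\quad\times\Big(\frac{C_F^3}{\lambda\underline\nu}\|\eta-y_d+\mathrm{div}\,\rho\|+\frac{C_F^2}{\lambda\underline\nu}\|\rho-\nu\nabla\zeta\|+C_F\|f+v+\mathrm{div}\,\tau\|+\|\tau-\nu\nabla\eta\|\Big).\end{aligned}$$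 Then: (0) For every $v\in L^2(\Omega)$ the state $y(v)$ exists and is unique; the control problem has a unique solution $(y(u),u)$; a pair $(y,u)$ is this solution if and only if $(y,u,p)$ satisfies the optimality system for some $p\in V$; and there is a constant $C_F>0$ for which the Friedrichs inequality $\|w\|\le C_F\|\nabla w\|$ holds for all $w\in V$. For every constant $C_F>0$ with $\|w\|\le C_F\|\nabla w\|$ for all $w\in V$: (1) for all $v\in U_{\rm ad}$, all $\eta,\zeta\in V$ and all $\tau,\rho\in H(\mathrm{div},\Omega)$, $$\mathcal J(y(v),v)\ \ge\ \mathcal J^\ominus(\eta,\zeta,\tau,\rho,v_\zeta);$$ (2) if $(y,u,p)$ satisfies the optimality system, then $$\sup_{\eta,\zeta\in V,\ \tau,\rho\in H(\mathrm{div},\Omega)}\mathcal J^\ominus(\eta,\zeta,\tau,\rho,v_\zeta)=\mathcal J(y(u),u),$$ and the supremum is attained at $\eta=y(u)$, $\zeta=p$, $\tau=\nu\nabla y(u)$, $\rho=\nu\nabla p$; these two fluxes belong to $H(\mathrm{div},\Omega)$, with $\mathrm{div}\,\tau=-(f+u)$ and $\mathrm{div}\,\rho=-(y(u)-y_d)$,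 and $v_\zeta=u$. -/

import Mathlib

open MeasureTheory Set
open scoped ENNReal ContDiff Gradient

noncomputable section

namespace EllipticControl

/-- The space `ℝ^d` with the Euclidean norm. -/
abbrev E (d : ℕ) := EuclideanSpace ℝ (Fin d)

/-- `L²(Ω)`. -/
abbrev L2 {d : ℕ} (Ω : Set (E d)) := Lp ℝ 2 (volume.restrict Ω)

/-- `[L²(Ω)]^d`. -/
abbrev L2V {d : ℕ} (Ω : Set (E d)) := Lp (E d) 2 (volume.restrict Ω)

/-- `L^∞(Ω)`. -/
abbrev Linf {d : ℕ} (Ω : Set (E d)) := Lp ℝ ∞ (volume.restrict Ω)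

/-- The Hilbert space `L²(Ω) × [L²(Ω)]^d`; a function `w` of `H¹(Ω)` is represented in it by the
pair `(w, ∇w)`, and the norm of this pair is the standard norm of `w` in `H¹(Ω)`. -/
abbrev Pair {d : ℕ} (Ω : Set (E d)) := WithLp 2 (L2 Ω × L2V Ω)

/-- Test functions: the elements of `C_c^∞(Ω)`. -/
structure IsTest {d : ℕ} (Ω : Set (E d)) (φ : E d → ℝ) : Prop where
  smooth : ContDiff ℝ ∞ φ
  compact : HasCompactSupport φ
  supp : tsupport φ ⊆ Ω

/-- The pairs `(φ, ∇φ)` with `φ ∈ C_c^∞(Ω)`. -/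
def testPairs {d : ℕ} (Ω : Set (E d)) : Submodule ℝ (Pair Ω) where
  carrier := {W | ∃ φ : E d → ℝ, IsTest Ω φ ∧
    W.fst =ᵐ[volume.restrict Ω] φ ∧ W.snd =ᵐ[volume.restrict Ω] ∇ φ}
  zero_mem' := by
    refine ⟨fun _ => 0, ⟨contDiff_const, HasCompactSupport.zero, ?_⟩, ?_, ?_⟩
    · simp [tsupport, Function.support]
    · exact Lp.coeFn_zero _ _ _
    · rw [gradient_fun_const']
      exact Lp.coeFn_zero _ _ _
  add_mem' := by
    rintro V W ⟨φ, hφ, h1, h2⟩ ⟨ψ, hψ, h3, h4⟩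
    refine ⟨φ + ψ, ⟨hφ.smooth.add hψ.smooth, hφ.compact.add hψ.compact,
      (tsupport_add φ ψ).trans (union_subset hφ.supp hψ.supp)⟩, ?_, ?_⟩
    · exact (Lp.coeFn_add V.fst W.fst).trans (h1.add h3)
    · refine (Lp.coeFn_add V.snd W.snd).trans ((h2.add h4).trans (.of_forall fun x => ?_))
      have hd1 : DifferentiableAt ℝ φ x := hφ.smooth.contDiffAt.differentiableAt (by simp)
      have hd2 : DifferentiableAt ℝ ψ x := hψ.smooth.contDiffAt.differentiableAt (by simp)
      simp [gradient, fderiv_add hd1 hd2]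
  smul_mem' := by
    rintro c W ⟨φ, hφ, h1, h2⟩
    refine ⟨c • φ, ⟨contDiff_const.smul hφ.smooth, ?_, ?_⟩, ?_, ?_⟩
    · exact hφ.compact.smul_left (f := fun _ => c)
    · exact (tsupport_smul_subset_right (fun _ => c) φ).trans hφ.supp
    · exact (Lp.coeFn_smul c W.fst).trans (h1.const_smul c)
    · refine (Lp.coeFn_smul c W.snd).trans ((h2.const_smul c).trans (.of_forall fun x => ?_))
      have hd1 : DifferentiableAt ℝ φ x := hφ.smooth.contDiffAt.differentiableAt (by simp)
      simp [gradient, fderiv_const_smul hd1]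

/-- `V = H¹₀(Ω)`, the closure of `C_c^∞(Ω)` in the norm of `H¹(Ω)`. The function is `W.fst`, its
(weak) gradient is `W.snd`. -/
def H10 {d : ℕ} (Ω : Set (E d)) : Submodule ℝ (Pair Ω) := (testPairs Ω).topologicalClosure

/-- `H(div, Ω)`: the pairs `(τ, div τ)` with `τ ∈ [L²(Ω)]^d` whose weak divergence `div τ`
belongs to `L²(Ω)`. -/
def Hdiv {d : ℕ} (Ω : Set (E d)) : Set (L2V Ω × L2 Ω) :=
  {T | ∀ φ : E d → ℝ, IsTest Ω φ →
    ∫ x in Ω, inner ℝ (T.1 x) (∇ φ x) = -∫ x in Ω, T.2 x * φ x}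

/-- The field `ν g`, the pointwise product of `ν ∈ L^∞(Ω)` and `g ∈ [L²(Ω)]^d`. -/
def flux {d : ℕ} {Ω : Set (E d)} (ν : Linf Ω) (g : L2V Ω) : L2V Ω := ν • g

/-- The set `U_ad` of admissible controls. -/
def Uad {d : ℕ} {Ω : Set (E d)} (ua ub : L2 Ω) : Set (L2 Ω) :=
  {v | ∀ᵐ x ∂(volume.restrict Ω), ua x ≤ v x ∧ v x ≤ ub x}

/-- `Y` is the state `y(v)`: the weak solution in `H¹₀(Ω)` of `-div (ν ∇y) = f + v`. -/
def IsState {d : ℕ} {Ω : Set (E d)} (ν : Linf Ω) (f v : L2 Ω) (Y : Pair Ω) : Prop :=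
  Y ∈ H10 Ω ∧ ∀ W ∈ H10 Ω, inner ℝ (flux ν Y.snd) W.snd = inner ℝ (f + v) W.fst

/-- `P` is the adjoint state of `Y`: the weak solution in `H¹₀(Ω)` of `-div (ν ∇p) = y - y_d`. -/
def IsAdjoint {d : ℕ} {Ω : Set (E d)} (ν : Linf Ω) (yd : L2 Ω) (Y P : Pair Ω) : Prop :=
  P ∈ H10 Ω ∧ ∀ W ∈ H10 Ω, inner ℝ (flux ν P.snd) W.snd = inner ℝ (Y.fst - yd) W.fst

/-- The cost functional `J(y, v)`. -/
def cost {d : ℕ} {Ω : Set (E d)} (yd ud : L2 Ω) (lam : ℝ) (Y : Pair Ω) (v : L2 Ω) : ℝ :=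
  1 / 2 * ‖Y.fst - yd‖ ^ 2 + lam / 2 * ‖v - ud‖ ^ 2

/-- `u` with state `Y` solves the optimal control problem. -/
def IsOptimal {d : ℕ} {Ω : Set (E d)} (ν : Linf Ω) (f yd ud ua ub : L2 Ω) (lam : ℝ)
    (Y : Pair Ω) (u : L2 Ω) : Prop :=
  u ∈ Uad ua ub ∧ IsState ν f u Y ∧
    ∀ v ∈ Uad ua ub, ∀ Z, IsState ν f v Z → cost yd ud lam Y u ≤ cost yd ud lam Z v

/-- The optimality system for the state `Y`, the control `u` and the adjoint state `P`. -/
def OptimalitySystem {d : ℕ} {Ω : Set (E d)} (ν : Linf Ω) (f yd ud ua ub : L2 Ω) (lam : ℝ)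
    (Y : Pair Ω) (u : L2 Ω) (P : Pair Ω) : Prop :=
  u ∈ Uad ua ub ∧ IsState ν f u Y ∧ IsAdjoint ν yd Y P ∧
    ∀ w ∈ Uad ua ub, 0 ≤ inner ℝ (P.fst + lam • (u - ud)) (w - u)

/-- `C` is a constant for the Friedrichs inequality `‖w‖ ≤ C ‖∇w‖` on `H¹₀(Ω)`. -/
def IsFriedrichsConstant {d : ℕ} (Ω : Set (E d)) (C : ℝ) : Prop :=
  0 < C ∧ ∀ W ∈ H10 Ω, ‖W.fst‖ ≤ C * ‖W.snd‖

/-- The control `v_ζ`: the pointwise projection `min {u_b, max {u_a, u_d - ζ / λ}}`. -/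
def projControl {d : ℕ} {Ω : Set (E d)} (ud ua ub : L2 Ω) (lam : ℝ) (ζ : L2 Ω) : L2 Ω :=
  ub ⊓ (ua ⊔ (ud - lam⁻¹ • ζ))

theorem projControl_ae {d : ℕ} {Ω : Set (E d)} (ud ua ub : L2 Ω) (lam : ℝ) (ζ : L2 Ω) :
    ∀ᵐ x ∂(volume.restrict Ω), projControl ud ua ub lam ζ x =
      min (ub x) (max (ua x) (ud x - 1 / lam * ζ x)) := by
  filter_upwards [Lp.coeFn_inf ub (ua ⊔ (ud - lam⁻¹ • ζ)), Lp.coeFn_sup ua (ud - lam⁻¹ • ζ),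
    Lp.coeFn_sub ud (lam⁻¹ • ζ), Lp.coeFn_smul lam⁻¹ ζ] with x h1 h2 h3 h4
  rw [projControl, h1, Pi.inf_apply, h2, Pi.sup_apply, h3, Pi.sub_apply, h4]
  simp

/-- The minorant `J⊖(η, ζ, τ, ρ, v)`; here `T = (τ, div τ)`, `R = (ρ, div ρ)`, and `νlo` is the
lower bound of `ν`. -/
def minorant {d : ℕ} {Ω : Set (E d)} (ν : Linf Ω) (νlo CF : ℝ) (f yd ud : L2 Ω) (lam : ℝ)
    (η ζ : Pair Ω) (T R : L2V Ω × L2 Ω) (v : L2 Ω) : ℝ :=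
  1 / 2 * ‖η.fst - yd‖ ^ 2 + lam / 2 * ‖v - ud‖ ^ 2
    + inner ℝ (f + v + T.2) ζ.fst + inner ℝ (T.1 - flux ν η.snd) ζ.snd
    - 1 / νlo * (CF * ‖η.fst - yd + R.2‖ + ‖R.1 - flux ν ζ.snd‖)
      * (CF ^ 3 / (lam * νlo) * ‖η.fst - yd + R.2‖
        + CF ^ 2 / (lam * νlo) * ‖R.1 - flux ν ζ.snd‖
        + CF * ‖f + v + T.2‖ + ‖T.1 - flux ν η.snd‖)

/-- The values of the minorant over all `η, ζ ∈ V`, `τ, ρ ∈ H(div, Ω)`, with `v = v_ζ`. -/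
def minorantValues {d : ℕ} {Ω : Set (E d)} (ν : Linf Ω) (νlo CF : ℝ) (f yd ud ua ub : L2 Ω)
    (lam : ℝ) : Set ℝ :=
  {m | ∃ η ∈ H10 Ω, ∃ ζ ∈ H10 Ω, ∃ T ∈ Hdiv Ω, ∃ R ∈ Hdiv Ω,
    m = minorant ν νlo CF f yd ud lam η ζ T R (projControl ud ua ub lam ζ.fst)}

end EllipticControl

end

open EllipticControl

/-! The bound is Lagrangian duality made computable. Let `L(η, w, ζ)` be the cost at `(η, w)` plus
`(f + w, ζ) - (ν∇η, ∇ζ)`. For the exact adjoint `Q` of `η`, completing squares gives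
(`cost_sub_lagrangian_eq`) `J(y(v), v) - L(η, w, Q) = ½‖y(v) - η‖² + (Q + λ(w - u_d), v - w) +
(λ/2)‖v - w‖²`. For `w = v_Q` the middle term is nonnegative, so the cost is at least `L(η, v_Q,
Q)`. To replace the unknown `Q` by `ζ`, note that `v_ζ` minimizes `L(η, ·, ζ)` over the admissible
set, so only `L(η, v_Q, ζ) - L(η, v_Q, Q)` must be bounded. It is a state residual tested with `ζ -
Q`. The a posteriori estimate gives `‖∇(ζ - Q)‖ ≤ k/ν̲` with `k` the weighted adjoint residual, and
the Lipschitz bound for the projection gives `‖v_Q - v_ζ‖ ≤ C_F k/(λν̲)`. Their product is the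
subtracted term of the minorant (`minorant_le_cost`). For exact data all residuals vanish and the
bound is attained. The same identity with `η`, `w` from the optimality system gives quadratic growth
of the cost, hence optimality and uniqueness. A solution of the system comes from a Hilbert-space
projection; necessity then follows from uniqueness. -/

namespace EllipticControl

/-! ### Multiplication by the coefficient `ν`: symmetry and ellipticity. -/

section Flux

variable {d : ℕ} {Ω : Set (E d)}

theorem inner_flux_comm (ν : Linf Ω) (g h : L2V Ω) :
    inner ℝ (flux ν g) h = inner ℝ (flux ν h) g := by
  rw [L2.inner_def, L2.inner_def]
  apply integral_congr_ae
  filter_upwards [Lp.coeFn_lpSMul (r := 2) ν g, Lp.coeFn_lpSMul (r := 2) ν h] with x h1 h2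
  rw [flux, flux, h1, h2, Pi.smul_apply', Pi.smul_apply', real_inner_smul_left,
    real_inner_smul_left, real_inner_comm]

theorem mul_norm_sq_le_inner_flux {ν : Linf Ω} {νlo : ℝ}
    (hν : ∀ᵐ x ∂(volume.restrict Ω), νlo ≤ ν x) (g : L2V Ω) :
    νlo * ‖g‖ ^ 2 ≤ inner ℝ (flux ν g) g := by
  rw [← real_inner_self_eq_norm_sq, L2.inner_def, L2.inner_def, ← integral_const_mul]
  refine integral_mono_ae ((L2.integrable_inner g g).const_mul _) (L2.integrable_inner _ _) ?_
  filter_upwards [Lp.coeFn_lpSMul (r := 2) ν g, hν] with x h1 h2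
  simp only [flux]
  rw [h1, Pi.smul_apply', real_inner_smul_left]
  exact mul_le_mul_of_nonneg_right h2 real_inner_self_nonneg

/-- Multiplication by `ν ∈ L^∞(Ω)` as a bounded operator on `[L²(Ω)]^d`. -/
noncomputable def fluxL (ν : Linf Ω) : L2V Ω →L[ℝ] L2V Ω :=
  LinearMap.mkContinuous
    { toFun := flux ν
      map_add' := fun g h => Lp.add_smul ν g h
      map_smul' := fun c g => (Lp.smul_comm c ν g).symm } ‖ν‖ (fun g => Lp.norm_smul_le ν g)

theorem flux_sub (ν : Linf Ω) (g h : L2V Ω) : flux ν (g - h) = flux ν g - flux ν h :=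
  map_sub (fluxL ν) g h

end Flux

/-! ### Test functions, density and Green's formula. -/

section Test

variable {d : ℕ} {Ω : Set (E d)}

theorem IsTest.continuous_gradient {φ : E d → ℝ} (hφ : IsTest Ω φ) : Continuous (∇ φ) :=
  (InnerProductSpace.toDual ℝ (E d)).symm.continuous.comp (hφ.smooth.continuous_fderiv (by simp))

theorem IsTest.hasCompactSupport_gradient {φ : E d → ℝ} (hφ : IsTest Ω φ) :
    HasCompactSupport (∇ φ) :=
  (hφ.compact.fderiv ℝ).comp_left (g := (InnerProductSpace.toDual ℝ (E d)).symm) (map_zero _)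

/-- The element of `H¹₀(Ω)` represented by a test function. -/
theorem IsTest.exists_pair {φ : E d → ℝ} (hφ : IsTest Ω φ) :
    ∃ W ∈ testPairs Ω, W.fst =ᵐ[volume.restrict Ω] φ ∧ W.snd =ᵐ[volume.restrict Ω] ∇ φ := by
  have h1 : MemLp φ 2 (volume.restrict Ω) :=
    (hφ.smooth.continuous.memLp_of_hasCompactSupport hφ.compact)
  have h2 : MemLp (∇ φ) 2 (volume.restrict Ω) :=
    (hφ.continuous_gradient.memLp_of_hasCompactSupport hφ.hasCompactSupport_gradient)
  exact ⟨WithLp.toLp 2 (h1.toLp, h2.toLp), ⟨φ, hφ, h1.coeFn_toLp, h2.coeFn_toLp⟩,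
    h1.coeFn_toLp, h2.coeFn_toLp⟩

theorem testPairs_le_H10 : testPairs Ω ≤ H10 Ω := Submodule.le_topologicalClosure _

/-- Density argument: it carries both Green's formula and the Friedrichs inequality from test
functions to their closure. -/
theorem H10_induction {p : Pair Ω → Prop} (hp : IsClosed {W | p W})
    (h : ∀ W ∈ testPairs Ω, p W) {W : Pair Ω} (hW : W ∈ H10 Ω) : p W :=
  closure_minimal (s := (testPairs Ω : Set (Pair Ω))) h hp hW

theorem continuous_pair_fst : Continuous fun W : Pair Ω => W.fst :=
  (WithLp.fstL 2 ℝ (L2 Ω) (L2V Ω)).continuous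

theorem continuous_pair_snd : Continuous fun W : Pair Ω => W.snd :=
  (WithLp.sndL 2 ℝ (L2 Ω) (L2V Ω)).continuous

theorem inner_eq_integral_of_ae_eq {F : Type*} [NormedAddCommGroup F] [InnerProductSpace ℝ F]
    {α : Type*} [MeasurableSpace α] {μ : Measure α} (g h : Lp F 2 μ) {k : α → F} (hk : h =ᵐ[μ] k) :
    inner ℝ g h = ∫ x, inner ℝ (g x) (k x) ∂μ := by
  rw [L2.inner_def]
  exact integral_congr_ae (hk.mono fun x hx => congrArg (inner ℝ (g x)) hx)

/-- A field with weak divergence satisfies Green's formula against all of `H¹₀(Ω)`. -/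
theorem inner_eq_neg_inner_of_mem_Hdiv {T : L2V Ω × L2 Ω} (hT : T ∈ Hdiv Ω) {W : Pair Ω}
    (hW : W ∈ H10 Ω) : inner ℝ T.1 W.snd = -inner ℝ T.2 W.fst := by
  refine H10_induction (p := fun W => inner ℝ T.1 W.snd = -inner ℝ T.2 W.fst) ?_ ?_ hW
  · exact isClosed_eq (continuous_const.inner continuous_pair_snd)
      (continuous_const.inner continuous_pair_fst).neg
  · rintro W ⟨φ, hφ, h1, h2⟩
    rw [inner_eq_integral_of_ae_eq _ _ h2, inner_eq_integral_of_ae_eq _ _ h1, hT φ hφ]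
    simp only [RCLike.inner_apply, conj_trivial, mul_comm]

theorem mem_Hdiv_of_inner_eq {T : L2V Ω × L2 Ω}
    (h : ∀ W ∈ H10 Ω, inner ℝ T.1 W.snd = -inner ℝ T.2 W.fst) : T ∈ Hdiv Ω := by
  intro φ hφ
  obtain ⟨W, hW, h1, h2⟩ := hφ.exists_pair
  rw [← inner_eq_integral_of_ae_eq _ _ h2, h W (testPairs_le_H10 hW),
    inner_eq_integral_of_ae_eq _ _ h1]
  simp only [RCLike.inner_apply, conj_trivial, mul_comm]

end Test

/-! ### The Friedrichs inequality. -/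

section Friedrichs

variable {d : ℕ} {Ω : Set (E d)}

theorem IsTest.integrable_sq {φ : E d → ℝ} (hφ : IsTest Ω φ) :
    Integrable fun x => φ x ^ 2 := by
  have hc : Continuous fun x => φ x ^ 2 := hφ.smooth.continuous.pow 2
  have hs : HasCompactSupport fun x => φ x ^ 2 :=
    hφ.compact.comp_left (g := fun t : ℝ => t ^ 2) (by simp)
  exact hc.integrable_of_hasCompactSupport hs

theorem IsTest.integrable_norm_gradient_sq {φ : E d → ℝ} (hφ : IsTest Ω φ) :
    Integrable fun x => ‖∇ φ x‖ ^ 2 := by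
  have hc : Continuous fun x => ‖∇ φ x‖ ^ 2 := hφ.continuous_gradient.norm.pow 2
  have hs : HasCompactSupport fun x => ‖∇ φ x‖ ^ 2 :=
    hφ.hasCompactSupport_gradient.comp_left (g := fun t : E d => ‖t‖ ^ 2) (by simp)
  exact hc.integrable_of_hasCompactSupport hs

theorem IsTest.integrable_coord_mul {φ : E d → ℝ} (hφ : IsTest Ω φ) (i : Fin d) (v : E d) :
    Integrable fun x => x i * (2 * φ x * inner ℝ (∇ φ x) v) := by
  have hco : Continuous fun y : E d => y i := (EuclideanSpace.proj i : E d →L[ℝ] ℝ).continuous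
  have hin : Continuous fun x => inner ℝ (∇ φ x) v := hφ.continuous_gradient.inner continuous_const
  exact (hco.mul ((continuous_const.mul hφ.smooth.continuous).mul hin)).integrable_of_hasCompactSupport
    ((hφ.compact.mul_left (f := fun _ => 2)).mul_right
      (f' := fun x => inner ℝ (∇ φ x) v)).mul_left

theorem IsTest.fderiv_sq_apply {φ : E d → ℝ} (hφ : IsTest Ω φ) (x v : E d) :
    fderiv ℝ (fun y => φ y ^ 2) x v = 2 * φ x * inner ℝ (∇ φ x) v := by
  have hfd : inner ℝ (∇ φ x) v = fderiv ℝ φ x v :=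
    InnerProductSpace.toDual_symm_apply
  rw [fderiv_fun_pow 2 (hφ.smooth.differentiable (by simp) x), hfd]
  simp

theorem fderiv_coord_apply_single (i : Fin d) (x : E d) :
    fderiv ℝ (fun y : E d => y i) x (EuclideanSpace.single i 1) = 1 := by
  have : (fun y : E d => y i) = (EuclideanSpace.proj i : E d →L[ℝ] ℝ) := rfl
  rw [this, ContinuousLinearMap.fderiv]
  simp

/-- Integration by parts of `x_i` against `φ²`, using `∂_i x_i = 1`; compact support removes the
boundary term. -/
theorem IsTest.integral_coord_mul {φ : E d → ℝ} (hφ : IsTest Ω φ) (i : Fin d) :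
    ∫ x, x i * (2 * φ x * inner ℝ (∇ φ x) (EuclideanSpace.single i 1)) = -∫ x, φ x ^ 2 := by
  have hco : Continuous fun y : E d => y i := (EuclideanSpace.proj i : E d →L[ℝ] ℝ).continuous
  have csq : HasCompactSupport fun x => φ x ^ 2 :=
    hφ.compact.comp_left (g := fun t : ℝ => t ^ 2) (by simp)
  have parts := integral_mul_fderiv_eq_neg_fderiv_mul_of_integrable (μ := volume)
    (v := EuclideanSpace.single i 1) (f := fun y : E d => y i) (g := fun y => φ y ^ 2)
    (by simpa only [fderiv_coord_apply_single, one_mul] using hφ.integrable_sq)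
    (by simpa only [hφ.fderiv_sq_apply] using hφ.integrable_coord_mul i _)
    ((hco.mul (hφ.smooth.continuous.pow 2)).integrable_of_hasCompactSupport csq.mul_left)
    (fun x _ => (EuclideanSpace.proj i : E d →L[ℝ] ℝ).differentiableAt)
    (fun x _ => (hφ.smooth.differentiable (by simp) x).pow 2)
  simpa only [hφ.fderiv_sq_apply, fderiv_coord_apply_single, one_mul] using parts

theorem IsTest.eq_zero_of_notMem {φ : E d → ℝ} (hφ : IsTest Ω φ) {x : E d} (hx : x ∉ Ω) :
    φ x = 0 :=
  image_eq_zero_of_notMem_tsupport fun h => hx (hφ.supp h)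

theorem IsTest.neg_coord_mul_le {φ : E d → ℝ} (hφ : IsTest Ω φ) (i : Fin d) {r : ℝ}
    (hr : ∀ x ∈ Ω, ‖x‖ ≤ r) (x : E d) :
    -(x i * (2 * φ x * inner ℝ (∇ φ x) (EuclideanSpace.single i 1))) ≤
      1 / 2 * φ x ^ 2 + 2 * r ^ 2 * ‖∇ φ x‖ ^ 2 := by
  by_cases hx : x ∈ Ω
  · have h1 : |inner ℝ (∇ φ x) (EuclideanSpace.single i (1 : ℝ))| ≤ ‖∇ φ x‖ :=
      (abs_real_inner_le_norm _ _).trans_eq (by rw [PiLp.norm_single]; simp)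
    have h2 : |x i| ≤ r := (PiLp.norm_apply_le x i).trans (hr x hx)
    generalize inner ℝ (∇ φ x) (EuclideanSpace.single i (1 : ℝ)) = t at h1 ⊢
    have h3 : |x i * t| ≤ r * ‖∇ φ x‖ := by
      rw [abs_mul]
      exact mul_le_mul h2 h1 (abs_nonneg _) ((abs_nonneg _).trans h2)
    have h4 : (x i * t) ^ 2 ≤ (r * ‖∇ φ x‖) ^ 2 := sq_le_sq' (abs_le.1 h3).1 (abs_le.1 h3).2
    -- Young's inequality: half of `(φ + 2s)² ≥ 0` with `s = x_i t` reads `-2φs ≤ φ²/2 + 2s²`.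
    linarith [sq_nonneg (φ x + 2 * (x i * t)), mul_pow r ‖∇ φ x‖ 2,
      add_sq (φ x) (2 * (x i * t)), mul_pow 2 (x i * t) 2]
  · rw [hφ.eq_zero_of_notMem hx]
    simp only [mul_zero, zero_mul, neg_zero]
    positivity

/-- The weight `1/2` in the pointwise bound lets the `φ²` term be absorbed on the left, which turns
`2r²` into `4r²`. -/
theorem IsTest.integral_sq_le {φ : E d → ℝ} (hφ : IsTest Ω φ) (i : Fin d) {r : ℝ}
    (hr : ∀ x ∈ Ω, ‖x‖ ≤ r) :
    ∫ x in Ω, φ x ^ 2 ≤ 4 * r ^ 2 * ∫ x in Ω, ‖∇ φ x‖ ^ 2 := by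
  have parts := hφ.integral_coord_mul i
  rw [← setIntegral_eq_integral_of_forall_compl_eq_zero (s := Ω)
      (fun x hx => by simp only [hφ.eq_zero_of_notMem hx, mul_zero, zero_mul]),
    ← setIntegral_eq_integral_of_forall_compl_eq_zero (s := Ω) (f := fun x => φ x ^ 2)
      (fun x hx => by simp [hφ.eq_zero_of_notMem hx])] at parts
  have i1 := hφ.integrable_sq.integrableOn (s := Ω).const_mul (1 / 2)
  have i2 := hφ.integrable_norm_gradient_sq.integrableOn (s := Ω).const_mul (2 * r ^ 2)
  have hint := integral_mono (μ := volume.restrict Ω)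
    (hφ.integrable_coord_mul i _).integrableOn.neg (i1.add i2) (hφ.neg_coord_mul_le i hr)
  simp only [Pi.neg_apply, Pi.add_apply] at hint
  rw [integral_neg, parts, integral_add i1 i2, integral_const_mul, integral_const_mul] at hint
  linarith

/-- The Friedrichs inequality on a bounded set. -/
theorem exists_isFriedrichsConstant (hd : 1 ≤ d) (hbdd : Bornology.IsBounded Ω) :
    ∃ C, IsFriedrichsConstant Ω C := by
  obtain ⟨r, hr0, hr⟩ := hbdd.exists_pos_norm_le
  refine ⟨2 * r, by positivity, fun W hW => ?_⟩
  refine H10_induction (p := fun W => ‖W.fst‖ ≤ 2 * r * ‖W.snd‖)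
    (isClosed_le continuous_pair_fst.norm (continuous_const.mul continuous_pair_snd.norm)) ?_ hW
  rintro W ⟨φ, hφ, h1, h2⟩
  refine le_of_sq_le_sq ?_ (by positivity)
  -- Any coordinate direction serves; index `0` exists because `d ≥ 1`.
  have key := hφ.integral_sq_le ⟨0, hd⟩ hr
  rw [mul_pow, ← real_inner_self_eq_norm_sq, ← real_inner_self_eq_norm_sq, L2.inner_def,
    L2.inner_def]
  calc _ = ∫ x in Ω, φ x ^ 2 := integral_congr_ae (h1.mono fun x hx => by simp [hx, sq])
    _ ≤ _ := key
    _ = _ := by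
      have e : ∫ x in Ω, inner ℝ (W.snd x) (W.snd x) = ∫ x in Ω, ‖∇ φ x‖ ^ 2 :=
        integral_congr_ae (h2.mono fun x hx =>
          (congrArg (fun z => inner ℝ z z) hx).trans (real_inner_self_eq_norm_sq _))
      rw [e]
      ring

end Friedrichs

/-! ### Variational inequalities and Lax–Milgram in Hilbert spaces. -/

section Hilbert

variable {H G K : Type*} [NormedAddCommGroup H] [InnerProductSpace ℝ H] [CompleteSpace H]
  [NormedAddCommGroup G] [InnerProductSpace ℝ G] [CompleteSpace G]
  [NormedAddCommGroup K] [InnerProductSpace ℝ K]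

-- Exact second-order expansion at `w` of `(λ/2)‖· - u‖² + (q, ·)`; the first term on the right is
-- its derivative at `w`.
omit [CompleteSpace H] in
theorem half_norm_sq_sub_eq (lam : ℝ) (v w u q : H) :
    lam / 2 * ‖v - u‖ ^ 2 - lam / 2 * ‖w - u‖ ^ 2 + inner ℝ q (v - w) =
      inner ℝ (q + lam • (w - u)) (v - w) + lam / 2 * ‖v - w‖ ^ 2 := by
  have h : v - u = (w - u) + (v - w) := by abel
  rw [h, norm_add_sq_real, inner_add_left, real_inner_smul_left]
  ring

omit [CompleteSpace H] in
/-- Solutions of variational inequalities depend on the data in a Lipschitz way. -/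
theorem norm_sub_le_of_variational_inequalities {lam : ℝ} (hlam : 0 < lam) {q ζ v w u : H}
    (hw : 0 ≤ inner ℝ (ζ + lam • (w - u)) (v - w))
    (hv : 0 ≤ inner ℝ (q + lam • (v - u)) (w - v)) : ‖v - w‖ ≤ 1 / lam * ‖q - ζ‖ := by
  -- Each inequality is tested with the solution of the other. Their sum gives `λ‖v - w‖² ≤ -(q - ζ,
  -- v - w)`, and Cauchy–Schwarz finishes.
  have e : inner ℝ (ζ + lam • (w - u)) (v - w) + inner ℝ (q + lam • (v - u)) (w - v) =
      -(inner ℝ (q - ζ) (v - w)) - lam * ‖v - w‖ ^ 2 := by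
    rw [← real_inner_self_eq_norm_sq, ← real_inner_smul_left, ← neg_sub v w, inner_neg_right,
      ← sub_eq_add_neg, ← inner_sub_left, ← inner_neg_left, ← inner_sub_left]
    congr 1
    simp only [smul_sub]; abel
  have h3 := (abs_le.1 (abs_real_inner_le_norm (q - ζ) (v - w))).1
  rw [one_div_mul_eq_div, le_div_iff₀ hlam]
  rcases (norm_nonneg (v - w)).eq_or_lt with h0 | h0
  · rw [← h0, zero_mul]; exact norm_nonneg _
  · refine le_of_mul_le_mul_right ?_ h0
    linarith [sq ‖v - w‖]

/-- The Lax–Milgram theorem for the form `(v, w) ↦ ⟪F (B v), B w⟫` and the functionals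
`w ↦ ⟪g, A w⟫`. -/
theorem exists_lax_milgram_operator (A : H →L[ℝ] G) (B : H →L[ℝ] K) (F : K →L[ℝ] K) {c : ℝ}
    (hc : 0 < c) (h : ∀ v, c * ‖v‖ ^ 2 ≤ inner ℝ (F (B v)) (B v)) :
    ∃ S : G →L[ℝ] H, ∀ g w, inner ℝ (F (B (S g))) (B w) = inner ℝ g (A w) := by
  let b : H →L[ℝ] H →L[ℝ] ℝ := (innerSL ℝ).bilinearComp (F.comp B) B
  have hb : IsCoercive b := ⟨c, hc, fun v => (by ring : c * ‖v‖ * ‖v‖ = _).trans_le (h v)⟩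
  refine ⟨(hb.continuousLinearEquivOfBilin.symm : H →L[ℝ] H).comp A.adjoint, fun g w => ?_⟩
  have h1 := hb.continuousLinearEquivOfBilin_apply
    (hb.continuousLinearEquivOfBilin.symm (A.adjoint g)) w
  rw [ContinuousLinearEquiv.apply_symm_apply, ContinuousLinearMap.adjoint_inner_left] at h1
  exact h1.symm

/-- The variational inequality for a linear-quadratic problem over a closed convex set. -/
theorem exists_variational_inequality_one (A : H →L[ℝ] G) {U : Set H} (hne : U.Nonempty)
    (hcl : IsClosed U) (hcx : Convex ℝ U) (a : G) (b : H) :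
    ∃ u ∈ U, ∀ w ∈ U, 0 ≤ inner ℝ (A u - a) (A (w - u)) + inner ℝ (u - b) (w - u) := by
  -- The minimizer is the projection of `(a, b)` onto the graph of `A` over `U`, a closed convex
  -- set; the characterization of the projection is the desired inequality.
  let K : Set (WithLp 2 (G × H)) := {z | z.snd ∈ U ∧ z.fst = A z.snd}
  have c1 : Continuous fun z : WithLp 2 (G × H) => z.fst := (WithLp.fstL 2 ℝ G H).continuous
  have c2 : Continuous fun z : WithLp 2 (G × H) => z.snd := (WithLp.sndL 2 ℝ G H).continuous
  have hK : IsClosed K := (hcl.preimage c2).inter (isClosed_eq c1 (A.continuous.comp c2))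
  have hKc : Convex ℝ K := by
    rintro x ⟨hx, hx'⟩ y ⟨hy, hy'⟩ s t hs ht hst
    refine ⟨hcx hx hy hs ht hst, ?_⟩
    simp [hx', hy']
  have hKn : K.Nonempty := by
    obtain ⟨u, hu⟩ := hne
    exact ⟨WithLp.toLp 2 (A u, u), hu, rfl⟩
  obtain ⟨z, hz, hmin⟩ := exists_norm_eq_iInf_of_complete_convex hKn hK.isComplete hKc
    (WithLp.toLp 2 (a, b))
  rw [norm_eq_iInf_iff_real_inner_le_zero hKc hz] at hmin
  refine ⟨z.snd, hz.1, fun w hw => ?_⟩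
  have := hmin (WithLp.toLp 2 (A w, w)) ⟨hw, rfl⟩
  rw [WithLp.prod_inner_apply] at this
  simp only [WithLp.ofLp_sub, Prod.fst_sub, Prod.snd_sub] at this
  change inner ℝ (a - z.fst) (A w - z.fst) + inner ℝ (b - z.snd) (w - z.snd) ≤ 0 at this
  rw [hz.2, ← neg_sub, inner_neg_left, ← neg_sub z.snd b, inner_neg_left, ← map_sub] at this
  linarith

theorem exists_variational_inequality (A : H →L[ℝ] G) {U : Set H} (hne : U.Nonempty)
    (hcl : IsClosed U) (hcx : Convex ℝ U) (a : G) (b : H) {lam : ℝ} (hlam : 0 < lam) :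
    ∃ u ∈ U, ∀ w ∈ U, 0 ≤ inner ℝ (A u - a) (A (w - u)) + lam * inner ℝ (u - b) (w - u) := by
  -- Scaling `A` and `a` by `λ^(-1/2)` and multiplying the result by `λ` puts the weight on the
  -- control term.
  set c := (Real.sqrt lam)⁻¹
  have hc : lam * (c * c) = 1 := by
    rw [← mul_inv, Real.mul_self_sqrt hlam.le, mul_inv_cancel₀ hlam.ne']
  obtain ⟨u, hu, h⟩ := exists_variational_inequality_one (c • A) hne hcl hcx (c • a) b
  refine ⟨u, hu, fun w hw => ?_⟩
  have h1 := mul_nonneg hlam.le (h w hw)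
  simp only [smul_apply, ← smul_sub, real_inner_smul_left,
    real_inner_smul_right] at h1
  linear_combination h1 + inner ℝ (A u - a) (A (w - u)) * hc

end Hilbert

/-! ### Weak solutions: uniqueness, existence and a posteriori estimates. -/

section WeakSolution

variable {d : ℕ} {Ω : Set (E d)}

/-- `Y` is the weak solution in `H¹₀(Ω)` of `-div (ν ∇Y) = g`. -/
def IsWeakSolution (ν : Linf Ω) (g : L2 Ω) (Y : Pair Ω) : Prop :=
  Y ∈ H10 Ω ∧ ∀ W ∈ H10 Ω, inner ℝ (flux ν Y.snd) W.snd = inner ℝ g W.fst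

theorem IsFriedrichsConstant.inner_add_inner_le {CF : ℝ} (hCF : IsFriedrichsConstant Ω CF)
    (g : L2 Ω) (h : L2V Ω) {W : Pair Ω} (hW : W ∈ H10 Ω) :
    inner ℝ g W.fst + inner ℝ h W.snd ≤ (CF * ‖g‖ + ‖h‖) * ‖W.snd‖ := by
  have h1 := real_inner_le_norm g W.fst
  have h2 := real_inner_le_norm h W.snd
  have h3 := mul_le_mul_of_nonneg_left (hCF.2 W hW) (norm_nonneg g)
  linarith

theorem norm_snd_le_of_inner_flux_le {ν : Linf Ω} {νlo : ℝ} (hνlo : 0 < νlo)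
    (hν : ∀ᵐ x ∂(volume.restrict Ω), νlo ≤ ν x) {g : L2V Ω} {k : ℝ} (hk : 0 ≤ k)
    (h : inner ℝ (flux ν g) g ≤ k * ‖g‖) : ‖g‖ ≤ 1 / νlo * k := by
  have h1 := (mul_norm_sq_le_inner_flux hν g).trans h
  rw [one_div_mul_eq_div, le_div_iff₀ hνlo]
  rcases (norm_nonneg g).eq_or_lt with h0 | h0
  · rw [← h0, zero_mul]; exact hk
  · refine le_of_mul_le_mul_right ?_ h0
    linarith [sq ‖g‖]

theorem norm_sq_le_of_mem_H10 {CF : ℝ} (hCF : IsFriedrichsConstant Ω CF) {W : Pair Ω}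
    (hW : W ∈ H10 Ω) : ‖W‖ ^ 2 ≤ (1 + CF ^ 2) * ‖W.snd‖ ^ 2 := by
  rw [WithLp.prod_norm_sq_eq_of_L2]
  have := pow_le_pow_left₀ (norm_nonneg _) (hCF.2 W hW) 2
  rw [mul_pow] at this
  linarith

theorem IsWeakSolution.unique {ν : Linf Ω} {νlo CF : ℝ} (hνlo : 0 < νlo)
    (hν : ∀ᵐ x ∂(volume.restrict Ω), νlo ≤ ν x) (hCF : IsFriedrichsConstant Ω CF) {g : L2 Ω}
    {Y Z : Pair Ω} (hY : IsWeakSolution ν g Y) (hZ : IsWeakSolution ν g Z) : Y = Z := by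
  have hm : Y - Z ∈ H10 Ω := sub_mem hY.1 hZ.1
  have h0 : inner ℝ (flux ν (Y - Z).snd) (Y - Z).snd = 0 := by
    rw [WithLp.sub_snd, flux_sub, inner_sub_left, ← WithLp.sub_snd, hY.2 _ hm, hZ.2 _ hm, sub_self]
  have h1 := norm_snd_le_of_inner_flux_le hνlo hν le_rfl (by rw [h0, zero_mul])
  rw [mul_zero] at h1
  have h2 := norm_sq_le_of_mem_H10 hCF hm
  rw [le_antisymm h1 (norm_nonneg _)] at h2
  have h3 : ‖Y - Z‖ ^ 2 = 0 := le_antisymm (by simpa using h2) (sq_nonneg _)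
  exact sub_eq_zero.1 (norm_eq_zero.1 (pow_eq_zero_iff two_ne_zero |>.1 h3))

/-- The Lax–Milgram theorem for `-div (ν ∇·)`: a bounded solution operator exists. -/
theorem exists_solution_operator {ν : Linf Ω} {νlo CF : ℝ} (hνlo : 0 < νlo)
    (hν : ∀ᵐ x ∂(volume.restrict Ω), νlo ≤ ν x) (hCF : IsFriedrichsConstant Ω CF) :
    ∃ S : L2 Ω →L[ℝ] Pair Ω, ∀ g, IsWeakSolution ν g (S g) := by
  have : CompleteSpace (H10 Ω) := (Submodule.isClosed_topologicalClosure _).completeSpace_coe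
  let ι := (H10 Ω).subtypeL
  let p₁ : H10 Ω →L[ℝ] L2 Ω := (WithLp.fstL 2 ℝ (L2 Ω) (L2V Ω)).comp ι
  let p₂ : H10 Ω →L[ℝ] L2V Ω := (WithLp.sndL 2 ℝ (L2 Ω) (L2V Ω)).comp ι
  -- Ellipticity controls only the gradient; the Friedrichs inequality bounds the full norm, at the
  -- cost of the factor `1 + C_F²`.
  obtain ⟨S, hS⟩ := exists_lax_milgram_operator p₁ p₂ (fluxL ν) (c := νlo / (1 + CF ^ 2))
    (by positivity) fun W => by
      rw [div_mul_eq_mul_div, div_le_iff₀ (by positivity)]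
      have h1 := mul_norm_sq_le_inner_flux hν (W : Pair Ω).snd
      have h2 := norm_sq_le_of_mem_H10 hCF W.2
      calc νlo * ‖W‖ ^ 2 ≤ νlo * ((1 + CF ^ 2) * ‖(W : Pair Ω).snd‖ ^ 2) :=
            mul_le_mul_of_nonneg_left h2 hνlo.le
        _ = (νlo * ‖(W : Pair Ω).snd‖ ^ 2) * (1 + CF ^ 2) := by ring
        _ ≤ _ := mul_le_mul_of_nonneg_right h1 (by positivity)
  exact ⟨ι.comp S, fun g => ⟨(S g).2, fun W hW => hS g ⟨W, hW⟩⟩⟩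

/-- The residual equation for an approximation `ζ` of a weak solution `Q`. -/
theorem IsWeakSolution.inner_flux_sub {ν : Linf Ω} {g : L2 Ω} {Q ζ W : Pair Ω}
    (hQ : IsWeakSolution ν g Q) {R : L2V Ω × L2 Ω} (hR : R ∈ Hdiv Ω) (hW : W ∈ H10 Ω) :
    inner ℝ (flux ν (Q - ζ).snd) W.snd =
      inner ℝ (g + R.2) W.fst + inner ℝ (R.1 - flux ν ζ.snd) W.snd := by
  rw [WithLp.sub_snd, flux_sub, inner_sub_left, inner_sub_left, inner_add_left, hQ.2 W hW,
    inner_eq_neg_inner_of_mem_Hdiv hR hW]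
  ring

/-- The functional a posteriori estimate for the energy error. -/
theorem IsWeakSolution.norm_snd_sub_le {ν : Linf Ω} {νlo CF : ℝ} (hνlo : 0 < νlo)
    (hν : ∀ᵐ x ∂(volume.restrict Ω), νlo ≤ ν x) (hCF : IsFriedrichsConstant Ω CF) {g : L2 Ω}
    {Q ζ : Pair Ω} (hQ : IsWeakSolution ν g Q) (hζ : ζ ∈ H10 Ω) {R : L2V Ω × L2 Ω}
    (hR : R ∈ Hdiv Ω) :
    ‖(Q - ζ).snd‖ ≤ 1 / νlo * (CF * ‖g + R.2‖ + ‖R.1 - flux ν ζ.snd‖) := by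
  have hC := hCF.1
  refine norm_snd_le_of_inner_flux_le hνlo hν (by positivity) ?_
  rw [hQ.inner_flux_sub hR (sub_mem hQ.1 hζ)]
  exact hCF.inner_add_inner_le _ _ (sub_mem hQ.1 hζ)

end WeakSolution

/-! ### Admissible controls and the pointwise projection. -/

section Uad

variable {d : ℕ} {Ω : Set (E d)}

theorem Uad_eq_Icc (ua ub : L2 Ω) : Uad ua ub = Icc ua ub := by
  ext v
  simp only [Uad, mem_ofPred_eq, mem_Icc, ← Lp.coeFn_le, Filter.eventually_and]
  rfl

theorem isClosed_Uad (ua ub : L2 Ω) : IsClosed (Uad ua ub) := by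
  rw [Uad_eq_Icc]; exact isClosed_Icc

theorem convex_Uad (ua ub : L2 Ω) : Convex ℝ (Uad ua ub) := by
  intro v hv w hw s t hs ht hst
  filter_upwards [hv, hw, Lp.coeFn_add (s • v) (t • w), Lp.coeFn_smul s v, Lp.coeFn_smul t w]
    with x h1 h2 h3 h4 h5
  rw [h3, Pi.add_apply, h4, h5]
  exact convex_Icc _ _ h1 h2 hs ht hst

theorem projControl_mem_Uad {ua ub : L2 Ω} (hab : ∀ᵐ x ∂(volume.restrict Ω), ua x ≤ ub x)
    (ud : L2 Ω) (lam : ℝ) (ζ : L2 Ω) : projControl ud ua ub lam ζ ∈ Uad ua ub := by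
  rw [Uad_eq_Icc]
  exact ⟨le_inf ((Lp.coeFn_le _ _).1 hab) le_sup_left, inf_le_left⟩

theorem inner_projControl_nonneg {lam : ℝ} (hlam : 0 < lam) {ua ub : L2 Ω}
    (ud ζ : L2 Ω) {w : L2 Ω} (hw : w ∈ Uad ua ub) :
    0 ≤ inner ℝ (ζ + lam • (projControl ud ua ub lam ζ - ud))
      (w - projControl ud ua ub lam ζ) := by
  rw [L2.inner_def]
  refine integral_nonneg_of_ae ?_
  set v := projControl ud ua ub lam ζ with hv
  filter_upwards [projControl_ae ud ua ub lam ζ, hw, Lp.coeFn_add ζ (lam • (v - ud)),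
    Lp.coeFn_smul lam (v - ud), Lp.coeFn_sub v ud, Lp.coeFn_sub w v] with x h1 h2 h3 h4 h5 h6
  rw [h3, h6, Pi.add_apply, h4, Pi.smul_apply, h5, Pi.sub_apply, Pi.sub_apply]
  rw [← hv] at h1
  simp only [Pi.zero_apply, RCLike.inner_apply, conj_trivial, smul_eq_mul]
  -- The integrand becomes `λ (v - t)(w - v)` with `v` the projection of `t` onto `[u_a, u_b]`; its
  -- sign is checked according to the position of `t`.
  have key : ζ x + lam * (v x - ud x) = lam * (v x - (ud x - 1 / lam * ζ x)) := by
    field_simp; ring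
  rw [key, mul_comm, mul_assoc]
  refine mul_nonneg hlam.le ?_
  generalize ud x - 1 / lam * ζ x = t at h1
  rcases le_total (ua x) t with h | h
  · rw [max_eq_right h] at h1
    rcases le_total (ub x) t with h' | h'
    · rw [min_eq_left h'] at h1
      exact mul_nonneg_of_nonpos_of_nonpos (by linarith) (by linarith [h2.2])
    · rw [min_eq_right h'] at h1
      simp [h1]
  · rw [max_eq_left h, min_eq_right (h2.1.trans h2.2)] at h1
    exact mul_nonneg (by linarith) (by linarith [h2.1])

/-- The variational inequality characterizes the projection. -/
theorem projControl_eq_of_inner_nonneg {lam : ℝ} (hlam : 0 < lam) {ua ub : L2 Ω}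
    (hab : ∀ᵐ x ∂(volume.restrict Ω), ua x ≤ ub x) {ud ζ u : L2 Ω} (hu : u ∈ Uad ua ub)
    (h : ∀ w ∈ Uad ua ub, 0 ≤ inner ℝ (ζ + lam • (u - ud)) (w - u)) :
    projControl ud ua ub lam ζ = u := by
  have h1 := norm_sub_le_of_variational_inequalities hlam
    (h _ (projControl_mem_Uad hab ud lam ζ)) (inner_projControl_nonneg hlam ud ζ hu)
  rw [sub_self, norm_zero, mul_zero] at h1
  exact sub_eq_zero.1 (norm_le_zero_iff.1 h1)

theorem norm_projControl_sub_le {lam : ℝ} (hlam : 0 < lam) {ua ub : L2 Ω}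
    (hab : ∀ᵐ x ∂(volume.restrict Ω), ua x ≤ ub x) (ud ζ q : L2 Ω) :
    ‖projControl ud ua ub lam q - projControl ud ua ub lam ζ‖ ≤ 1 / lam * ‖q - ζ‖ :=
  norm_sub_le_of_variational_inequalities hlam
    (inner_projControl_nonneg hlam ud ζ (projControl_mem_Uad hab ud lam q))
    (inner_projControl_nonneg hlam ud q (projControl_mem_Uad hab ud lam ζ))

end Uad

/-! ### Duality gap, optimality system and minorant. -/

section Control

variable {d : ℕ} {Ω : Set (E d)} {ν : Linf Ω} {νlo CF lam : ℝ} {f yd ud ua ub : L2 Ω}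

/-- Duality gap identity: the cost minus the Lagrangian at the exact adjoint `Q` of `η`. -/
theorem cost_sub_lagrangian_eq {v : L2 Ω} {Y η Q : Pair Ω} (hY : IsState ν f v Y)
    (hη : η ∈ H10 Ω) (hQ : IsWeakSolution ν (η.fst - yd) Q) (w : L2 Ω) :
    cost yd ud lam Y v - (1 / 2 * ‖η.fst - yd‖ ^ 2 + lam / 2 * ‖w - ud‖ ^ 2
      + inner ℝ (f + w) Q.fst - inner ℝ (flux ν η.snd) Q.snd) =
      1 / 2 * ‖(Y - η).fst‖ ^ 2 + inner ℝ (Q.fst + lam • (w - ud)) (v - w)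
        + lam / 2 * ‖v - w‖ ^ 2 := by
  have h1 : ‖Y.fst - yd‖ ^ 2 = ‖(Y - η).fst‖ ^ 2
      + 2 * inner ℝ (η.fst - yd) (Y - η).fst + ‖η.fst - yd‖ ^ 2 := by
    rw [real_inner_comm, ← norm_add_sq_real, WithLp.sub_fst, sub_add_sub_cancel]
  -- The adjoint equation is tested with `Y - η` and the state equation with `Q`; symmetry of the
  -- form joins them.
  have h2 : inner ℝ (η.fst - yd) (Y - η).fst =
      inner ℝ (f + v) Q.fst - inner ℝ (flux ν η.snd) Q.snd := by
    rw [← hQ.2 _ (sub_mem hY.1 hη), inner_flux_comm, WithLp.sub_snd, flux_sub, inner_sub_left,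
      hY.2 _ hQ.1]
  have h3 := half_norm_sq_sub_eq lam v w ud Q.fst
  have h4 : inner ℝ Q.fst (v - w) = inner ℝ (f + v) Q.fst - inner ℝ (f + w) Q.fst := by
    rw [← inner_sub_left, add_sub_add_left_eq_sub, real_inner_comm]
  rw [cost, h1, h2]
  linarith

/-- The cost of a control exceeds the cost of a solution of the optimality system by at least the
squared distance of the controls. -/
theorem OptimalitySystem.cost_add_le {Y P : Pair Ω} {u : L2 Ω}
    (h : OptimalitySystem ν f yd ud ua ub lam Y u P) {v : L2 Ω} (hv : v ∈ Uad ua ub)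
    {Z : Pair Ω} (hZ : IsState ν f v Z) :
    cost yd ud lam Y u + lam / 2 * ‖v - u‖ ^ 2 ≤ cost yd ud lam Z v := by
  obtain ⟨-, hY, hP, hvi⟩ := h
  have h1 := cost_sub_lagrangian_eq (ud := ud) (lam := lam) hZ hY.1 hP u
  have h2 := hY.2 P hP.1
  have h3 := hvi v hv
  have h4 : cost yd ud lam Y u = 1 / 2 * ‖Y.fst - yd‖ ^ 2 + lam / 2 * ‖u - ud‖ ^ 2 := rfl
  have h5 := sq_nonneg ‖(Z - Y).fst‖
  linarith

theorem OptimalitySystem.isOptimal (hlam : 0 < lam) {Y P : Pair Ω} {u : L2 Ω}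
    (h : OptimalitySystem ν f yd ud ua ub lam Y u P) : IsOptimal ν f yd ud ua ub lam Y u := by
  refine ⟨h.1, h.2.1, fun v hv Z hZ => ?_⟩
  have h1 := h.cost_add_le hv hZ
  have h2 : 0 ≤ lam / 2 * ‖v - u‖ ^ 2 := by positivity
  linarith

theorem OptimalitySystem.eq_of_isOptimal (hlam : 0 < lam) (hνlo : 0 < νlo)
    (hν : ∀ᵐ x ∂(volume.restrict Ω), νlo ≤ ν x) (hCF : IsFriedrichsConstant Ω CF)
    {Y P Z : Pair Ω} {u v : L2 Ω} (h : OptimalitySystem ν f yd ud ua ub lam Y u P)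
    (hv : IsOptimal ν f yd ud ua ub lam Z v) : Z = Y ∧ v = u := by
  have h1 := h.cost_add_le hv.1 hv.2.1
  have h2 := hv.2.2 u h.1 Y h.2.1
  have h3 : ‖v - u‖ ^ 2 ≤ 0 := by
    refine le_of_mul_le_mul_left ?_ (half_pos hlam)
    linarith
  obtain rfl : v = u := sub_eq_zero.1 (norm_eq_zero.1 (pow_eq_zero_iff two_ne_zero |>.1
    (le_antisymm h3 (sq_nonneg _))))
  exact ⟨IsWeakSolution.unique hνlo hν hCF hv.2.1 h.2.1, rfl⟩

theorem exists_optimalitySystem (hlam : 0 < lam) (hνlo : 0 < νlo)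
    (hν : ∀ᵐ x ∂(volume.restrict Ω), νlo ≤ ν x) (hCF : IsFriedrichsConstant Ω CF)
    (f yd ud : L2 Ω) (hab : ∀ᵐ x ∂(volume.restrict Ω), ua x ≤ ub x) :
    ∃ Y u P, OptimalitySystem ν f yd ud ua ub lam Y u P := by
  obtain ⟨S, hS⟩ := exists_solution_operator hνlo hν hCF
  let A : L2 Ω →L[ℝ] L2 Ω := (WithLp.fstL 2 ℝ (L2 Ω) (L2V Ω)).comp S
  obtain ⟨u, hu, hvi⟩ := exists_variational_inequality A
    ⟨ua, hab.mono fun x hx => ⟨le_rfl, hx⟩⟩ (isClosed_Uad ua ub) (convex_Uad ua ub)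
    (yd - A f) ud hlam
  refine ⟨S (f + u), u, S ((S (f + u)).fst - yd), hu, hS _, hS _, fun w hw => ?_⟩
  -- The solution operator is symmetric: testing each of the two equations with the solution of the
  -- other moves it from the adjoint state onto `w - u`.
  have h1 : inner ℝ (S ((S (f + u)).fst - yd)).fst (w - u) =
      inner ℝ (A u - (yd - A f)) (A (w - u)) := by
    have h2 := (hS ((S (f + u)).fst - yd)).2 _ (hS (w - u)).1
    rw [inner_flux_comm, (hS (w - u)).2 _ (hS _).1] at h2
    rw [real_inner_comm, h2]
    have h3 : (S (f + u)).fst - yd = A u - (yd - A f) := by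
      change A (f + u) - yd = _
      rw [map_add]
      abel
    rw [h3]
    rfl
  rw [inner_add_left, h1, real_inner_smul_left]
  exact hvi w hw

/-- Rewriting the minorant: the Lagrangian minus the error majorant. -/
theorem minorant_eq_lagrangian_sub (hlam : 0 < lam) (hνlo : 0 < νlo) {η ζ : Pair Ω}
    (hζ : ζ ∈ H10 Ω) {T R : L2V Ω × L2 Ω} (hT : T ∈ Hdiv Ω) (v : L2 Ω) :
    minorant ν νlo CF f yd ud lam η ζ T R v =
      1 / 2 * ‖η.fst - yd‖ ^ 2 + lam / 2 * ‖v - ud‖ ^ 2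
        + inner ℝ (f + v) ζ.fst - inner ℝ (flux ν η.snd) ζ.snd
        - 1 / νlo * (CF * ‖η.fst - yd + R.2‖ + ‖R.1 - flux ν ζ.snd‖) *
          (CF * ‖f + v + T.2‖ + ‖T.1 - flux ν η.snd‖
            + CF * (1 / lam * (CF * (1 / νlo *
              (CF * ‖η.fst - yd + R.2‖ + ‖R.1 - flux ν ζ.snd‖))))) := by
  -- Green's formula cancels `(div τ, ζ) + (τ, ∇ζ)`. The constants `C_F³/(λν̲)` and `C_F²/(λν̲)`
  -- come from expanding the nested bound for `C_F ‖v_Q - v_ζ‖`.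
  rw [minorant, inner_add_left (f + v), inner_sub_left T.1,
    inner_eq_neg_inner_of_mem_Hdiv hT hζ]
  field_simp
  ring

/-- The minorant at the projected control bounds the cost of each admissible control from below. -/
theorem minorant_le_cost (hlam : 0 < lam) (hνlo : 0 < νlo)
    (hν : ∀ᵐ x ∂(volume.restrict Ω), νlo ≤ ν x) (hCF : IsFriedrichsConstant Ω CF)
    (hab : ∀ᵐ x ∂(volume.restrict Ω), ua x ≤ ub x) {v : L2 Ω} (hv : v ∈ Uad ua ub)
    {Y η ζ : Pair Ω} (hY : IsState ν f v Y) (hη : η ∈ H10 Ω) (hζ : ζ ∈ H10 Ω)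
    {T R : L2V Ω × L2 Ω} (hT : T ∈ Hdiv Ω) (hR : R ∈ Hdiv Ω) :
    minorant ν νlo CF f yd ud lam η ζ T R (projControl ud ua ub lam ζ.fst)
      ≤ cost yd ud lam Y v := by
  have hC := hCF.1
  obtain ⟨S, hS⟩ := exists_solution_operator hνlo hν hCF
  obtain ⟨Q, hQ⟩ : ∃ Q, IsWeakSolution ν (η.fst - yd) Q := ⟨_, hS _⟩
  rw [minorant_eq_lagrangian_sub hlam hνlo hζ hT]
  set w := projControl ud ua ub lam ζ.fst with hw
  set q := projControl ud ua ub lam Q.fst with hq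
  set k := CF * ‖η.fst - yd + R.2‖ + ‖R.1 - flux ν ζ.snd‖
  have hm : ζ - Q ∈ H10 Ω := sub_mem hζ hQ.1
  have hk : ‖(ζ - Q).snd‖ ≤ 1 / νlo * k := by
    have := hQ.norm_snd_sub_le hνlo hν hCF hζ hR
    rwa [WithLp.sub_snd, norm_sub_rev, ← WithLp.sub_snd] at this
  have hqw : ‖q - w‖ ≤ 1 / lam * (CF * (1 / νlo * k)) := by
    refine (norm_projControl_sub_le hlam hab ud ζ.fst Q.fst).trans ?_
    rw [norm_sub_rev, ← WithLp.sub_fst]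
    gcongr
    exact (hCF.2 _ hm).trans (by gcongr)
  -- the cost dominates the Lagrangian at `(η, q, Q)`
  have h1 := cost_sub_lagrangian_eq (ud := ud) (lam := lam) hY hη hQ q
  have h2 := inner_projControl_nonneg hlam ud Q.fst hv
  rw [← hq] at h2
  have h3 : 0 ≤ 1 / 2 * ‖(Y - η).fst‖ ^ 2 + lam / 2 * ‖v - q‖ ^ 2 := by positivity
  -- `w` minimizes the Lagrangian at `(η, ·, ζ)`
  have h4 := half_norm_sq_sub_eq lam q w ud ζ.fst
  have h5 := inner_projControl_nonneg hlam ud ζ.fst (projControl_mem_Uad hab ud lam Q.fst)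
  rw [← hw, ← hq] at h5
  have h6 : 0 ≤ lam / 2 * ‖q - w‖ ^ 2 := by positivity
  have h7 : inner ℝ ζ.fst (q - w) = inner ℝ (f + q) ζ.fst - inner ℝ (f + w) ζ.fst := by
    rw [← inner_sub_left, add_sub_add_left_eq_sub, real_inner_comm]
  -- comparison of the Lagrangians at `(η, q, ζ)` and `(η, q, Q)`
  have h8 : inner ℝ (f + q) ζ.fst - inner ℝ (flux ν η.snd) ζ.snd
      - (inner ℝ (f + q) Q.fst - inner ℝ (flux ν η.snd) Q.snd) =
      inner ℝ (f + w + T.2) (ζ - Q).fst + inner ℝ (T.1 - flux ν η.snd) (ζ - Q).snd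
        + inner ℝ (q - w) (ζ - Q).fst := by
    rw [inner_add_left (f + w), inner_sub_left T.1, inner_eq_neg_inner_of_mem_Hdiv hT hm,
      WithLp.sub_fst, WithLp.sub_snd]
    simp only [inner_sub_left, inner_sub_right, inner_add_left]
    ring
  have h9 := hCF.inner_add_inner_le (f + w + T.2) (T.1 - flux ν η.snd) hm
  have h10 := hCF.inner_add_inner_le (q - w) 0 hm
  rw [inner_zero_left, norm_zero, add_zero, add_zero] at h10
  -- The bounds `hk` and `hqw` eliminate the unknown `Q`, leaving only computable quantities.
  have h11 : (CF * ‖f + w + T.2‖ + ‖T.1 - flux ν η.snd‖ + CF * ‖q - w‖) * ‖(ζ - Q).snd‖ ≤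
      (CF * ‖f + w + T.2‖ + ‖T.1 - flux ν η.snd‖ + CF * (1 / lam * (CF * (1 / νlo * k)))) *
        (1 / νlo * k) := by
    gcongr
  linarith

theorem minorant_exact (Y P : Pair Ω) (u : L2 Ω) :
    minorant ν νlo CF f yd ud lam Y P (flux ν Y.snd, -(f + u))
      (flux ν P.snd, -(Y.fst - yd)) u = cost yd ud lam Y u := by
  simp [minorant, cost]

theorem IsWeakSolution.mem_Hdiv {g : L2 Ω} {Y : Pair Ω} (h : IsWeakSolution ν g Y) :
    (flux ν Y.snd, -g) ∈ Hdiv Ω :=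
  mem_Hdiv_of_inner_eq fun W hW => by rw [h.2 W hW, inner_neg_left, neg_neg]

end Control

end EllipticControl

/-! ### Assembly of the theorem. -/

theorem mainTheorem1 {d : ℕ} (hd : 1 ≤ d) (Ω : Set (E d)) (hΩ : IsOpen Ω)
    (hbdd : Bornology.IsBounded Ω) (yd ud f ua ub : L2 Ω)
    (hab : ∀ᵐ x ∂(volume.restrict Ω), ua x ≤ ub x) (lam : ℝ) (hlam : 0 < lam)
    (ν : Linf Ω) (νlo : ℝ) (hνlo : 0 < νlo) (hν : ∀ᵐ x ∂(volume.restrict Ω), νlo ≤ ν x) :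
    (∀ v : L2 Ω, ∃! Y : Pair Ω, IsState ν f v Y) ∧
    (∃! S : Pair Ω × L2 Ω, IsOptimal ν f yd ud ua ub lam S.1 S.2) ∧
    (∀ (Y : Pair Ω) (u : L2 Ω), IsOptimal ν f yd ud ua ub lam Y u ↔
      ∃ P : Pair Ω, OptimalitySystem ν f yd ud ua ub lam Y u P) ∧
    (∃ CF : ℝ, IsFriedrichsConstant Ω CF) ∧
    ∀ CF : ℝ, IsFriedrichsConstant Ω CF →
      (∀ v ∈ Uad ua ub, ∀ Y : Pair Ω, IsState ν f v Y →
        ∀ η ∈ H10 Ω, ∀ ζ ∈ H10 Ω, ∀ T ∈ Hdiv Ω, ∀ R ∈ Hdiv Ω,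
          minorant ν νlo CF f yd ud lam η ζ T R (projControl ud ua ub lam ζ.fst)
            ≤ cost yd ud lam Y v) ∧
      (∀ (Y : Pair Ω) (u : L2 Ω) (P : Pair Ω), OptimalitySystem ν f yd ud ua ub lam Y u P →
        IsLUB (minorantValues ν νlo CF f yd ud ua ub lam) (cost yd ud lam Y u) ∧
        (flux ν Y.snd, -(f + u)) ∈ Hdiv Ω ∧ (flux ν P.snd, -(Y.fst - yd)) ∈ Hdiv Ω ∧
        projControl ud ua ub lam P.fst = u ∧
        minorant ν νlo CF f yd ud lam Y P (flux ν Y.snd, -(f + u))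
          (flux ν P.snd, -(Y.fst - yd)) u = cost yd ud lam Y u) := by
  obtain ⟨C, hC⟩ := exists_isFriedrichsConstant hd hbdd
  obtain ⟨S, hS⟩ := exists_solution_operator hνlo hν hC
  obtain ⟨Y₀, u₀, P₀, h₀⟩ := exists_optimalitySystem hlam hνlo hν hC f yd ud hab
  refine ⟨fun v => ⟨S (f + v), hS _, fun Z hZ => IsWeakSolution.unique hνlo hν hC hZ (hS _)⟩,
    ⟨(Y₀, u₀), h₀.isOptimal hlam, fun Z hZ => ?_⟩, fun Y u => ⟨fun h => ?_, ?_⟩, ⟨C, hC⟩,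
    fun CF hCF => ⟨fun v hv Y hY η hη ζ hζ T hT R hR =>
      minorant_le_cost hlam hνlo hν hCF hab hv hY hη hζ hT hR, fun Y u P h => ?_⟩⟩
  · obtain ⟨h1, h2⟩ := h₀.eq_of_isOptimal hlam hνlo hν hC hZ
    exact Prod.ext h1 h2
  -- Necessity without differentiating the cost: an optimal pair coincides with the constructed one,
  -- which already has an adjoint state.
  · obtain ⟨rfl, rfl⟩ := h₀.eq_of_isOptimal hlam hνlo hν hC h
    exact ⟨P₀, h₀⟩
  · rintro ⟨P, h⟩
    exact h.isOptimal hlam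
  · obtain ⟨hu, hY, hP, hvi⟩ := h
    have hT := IsWeakSolution.mem_Hdiv hY
    have hR := IsWeakSolution.mem_Hdiv hP
    have hproj := projControl_eq_of_inner_nonneg hlam hab hu hvi
    have hval := minorant_exact (νlo := νlo) (CF := CF) (yd := yd) (ud := ud) (lam := lam) (ν := ν) (f := f) Y P u
    refine ⟨⟨?_, fun b hb => hb ⟨Y, hY.1, P, hP.1, _, hT, _, hR, ?_⟩⟩, hT, hR, hproj, hval⟩
    · rintro m ⟨η, hη, ζ, hζ, T, hT, R, hR, rfl⟩
      exact minorant_le_cost hlam hνlo hν hCF hab hu hY hη hζ hT hR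
    · rw [hproj, hval]
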